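/- Partitions are weakly decreasing finite sequences of positive integers, padded by zeros when convenient; $l(\lambda)$ is the number of parts, $|\lambda|$ the sum of the parts, $\lambda'$ the conjugate partition, and $\eta\cup\zeta$ the partition whose multiset of parts is the sum (with multiplicities) of those of $\eta$ and $\zeta$. Let $(K_{\lambda\mu})$ be the Kostka matrix, defined by $s_\lambda=\sum_\mu K_{\lambda\mu}m_\mu$, where $m_\mu$ are the monomial symmetric polynomials, $s_\lambda=a_{\lambda+\delta}/a_\delta$ are the Schur polynomials in $n$ variables with $a_\alpha(x)=\sum_{\sigma\in\mathfrak S_n}\mathrm{sgn}(\sigma)\,\sigma(x^\alpha)$ and $\delta=(n-1,\ldots,1,0)$, and $n$ is at least the length of the partitions involved (the entries do not depend on $n$). Let $K^{-1}_{\lambda\mu}$ be the entries of the inverse matrix; $K_{\lambda\mu}=K^{-1}_{\lambda\mu}=0$ if $|\lambda|\neq|\mu|$. Let $\widetilde{\mathscr P}^{(2)}$ be the set of partitions all of whose parts are at most $2$. For $\sigma_1,\sigma_2\in\mathfrak S_2$ and $u=(u_1,u_2),v=(v_1,v_2)\in(\mathbb Z_{\geq0})^2$, let $C(u,v;\sigma_1,\sigma_2)$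 be the set of partitions $\lambda=(\lambda_1,\lambda_2)$ with $\lambda_1\ge\lambda_2\ge0$ such that $\lambda_1+\lambda_2=u_1+u_2+v_1+v_2-2$ and $\lambda_2\geq u_{\sigma_1(2)}+v_{\sigma_2(2)}$. Then for every $\xi\in\widetilde{\mathscr P}^{(2)}$ and all $u,v\in(\mathbb Z_{\geq0})^2$ with $u_2<u_1$ and $v_2<v_1$, \[\sum_{\substack{\eta,\zeta\in\widetilde{\mathscr P}^{(2)}\\ \eta\cup\zeta=\xi}}K^{-1}_{\eta\,(u_1-1,u_2)'}\,K^{-1}_{\zeta\,(v_1-1,v_2)'}=\sum_{\sigma_1,\sigma_2\in\mathfrak S_2}\mathrm{sgn}(\sigma_1)\,\mathrm{sgn}(\sigma_2)\sum_{\lambda\in C(u,v;\sigma_1,\sigma_2)}K^{-1}_{\xi\lambda'}.\] -/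

import Mathlib

open MvPolynomial in
/-- The antisymmetric polynomial `a_α(x) = ∑_σ sgn(σ) σ(x^α)` in the variables `x_1, …, x_n`,
where `σ` acts by `(σ f)(x_1, …, x_n) = f(x_{σ(1)}, …, x_{σ(n)})`. -/
noncomputable def alternant {n : ℕ} (α : Fin n → ℕ) : MvPolynomial (Fin n) ℚ :=
  ∑ σ : Equiv.Perm (Fin n), ((Equiv.Perm.sign σ : ℤ) : MvPolynomial (Fin n) ℚ) *
    rename σ (∏ i, X i ^ α i)

/-- The staircase `δ = (n-1, n-2, …, 1, 0)`. -/
def staircase (n : ℕ) : Fin n → ℕ := fun i => n - 1 - i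

theorem alternant_eq_det {n : ℕ} (α : Fin n → ℕ) :
    alternant α = (Matrix.of fun i j : Fin n =>
      (MvPolynomial.X i : MvPolynomial (Fin n) ℚ) ^ α j).det := by
  rw [Matrix.det_apply', alternant]
  refine Finset.sum_congr rfl fun σ _ => ?_
  simp [map_prod]

/-- The divisibility that makes the Schur polynomial well defined as a polynomial. -/
theorem alternant_staircase_dvd {n : ℕ} (α : Fin n → ℕ) :
    alternant (staircase n) ∣ alternant α := by
  classical
  set V : Matrix (Fin n) (Fin n) (MvPolynomial (Fin n) ℚ) :=
    Matrix.of fun i j => MvPolynomial.X i ^ staircase n j with hV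
  set p : Polynomial (MvPolynomial (Fin n) ℚ) :=
    ∏ i : Fin n, (Polynomial.X - Polynomial.C (MvPolynomial.X i)) with hp
  have hmonic : p.Monic := Polynomial.monic_prod_of_monic _ _ fun i _ => Polynomial.monic_X_sub_C _
  have hdeg : p.natDegree = n := by simp [hp]
  have hroot : ∀ i : Fin n, p.IsRoot (MvPolynomial.X i) := fun i => by
    rw [Polynomial.IsRoot.def, hp, Polynomial.eval_prod]
    exact Finset.prod_eq_zero (Finset.mem_univ i) (by simp)
  set C : Matrix (Fin n) (Fin n) (MvPolynomial (Fin n) ℚ) :=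
    Matrix.of fun k j => ((Polynomial.X ^ α j) %ₘ p).coeff (staircase n k) with hC
  have hfac : (Matrix.of fun i j : Fin n =>
      (MvPolynomial.X i : MvPolynomial (Fin n) ℚ) ^ α j) = V * C := by
    ext1 i j
    have hlt : ((Polynomial.X ^ α j : Polynomial (MvPolynomial (Fin n) ℚ)) %ₘ p).natDegree < n := by
      have hne : p ≠ 1 := by
        intro h
        have := hroot i
        rw [h] at this
        simp at this
      have := Polynomial.natDegree_modByMonic_lt (Polynomial.X ^ α j) hmonic hne
      omega
    have h1 : ((Polynomial.X ^ α j : Polynomial (MvPolynomial (Fin n) ℚ)) %ₘ p).eval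
        (MvPolynomial.X i) = MvPolynomial.X i ^ α j := by
      have h := congrArg (Polynomial.eval (MvPolynomial.X i))
        (Polynomial.modByMonic_add_div (Polynomial.X ^ α j) p)
      simpa [(hroot i).eq_zero] using h
    rw [Polynomial.eval_eq_sum_range' hlt] at h1
    simp only [Matrix.of_apply, Matrix.mul_apply, hV, hC]
    rw [← h1, Finset.sum_range, ← Equiv.sum_comp Fin.revPerm]
    refine Finset.sum_congr rfl fun k _ => ?_
    have : ((Fin.revPerm k : Fin n) : ℕ) = staircase n k := by
      simp [staircase, Fin.val_rev]; omega
    rw [this, mul_comm]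
  rw [alternant_eq_det, alternant_eq_det α, hfac, Matrix.det_mul]
  exact Dvd.intro _ rfl

/-- The Schur polynomial `s_α(x) = a_{α+δ}(x) / a_δ(x)` in `n` variables, the exact quotient of
polynomials (`a_δ ≠ 0`, so it is unique). -/
noncomputable def schurPoly {n : ℕ} (α : Fin n → ℕ) : MvPolynomial (Fin n) ℚ :=
  (alternant_staircase_dvd (α + staircase n)).choose

theorem schurPoly_spec {n : ℕ} (α : Fin n → ℕ) :
    alternant (staircase n) * schurPoly α = alternant (α + staircase n) :=
  (alternant_staircase_dvd (α + staircase n)).choose_spec.symm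

/-- A partition of `d` written as a weakly decreasing sequence `(lam_1, …, lam_d)`, padded with
zeros; every partition of `d` has at most `d` parts. -/
def rowVec {d : ℕ} (lam : d.Partition) : Fin d → ℕ :=
  fun i => (lam.parts.sort (· ≥ ·)).getD i 0

/-- The Kostka matrix on the partitions of `d`. The entry at `(lam, mu)` is the coefficient of the
monomial symmetric polynomial `m_mu` in the Schur polynomial `s_lam`, which is the coefficient of
`x^mu` in `s_lam`. The polynomials are taken in `d` variables, so that all partitions of `d`
occur. Entries between partitions of different numbers vanish, so that the full Kostka matrix is
block diagonal with these blocks. -/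
noncomputable def kostka (d : ℕ) : Matrix d.Partition d.Partition ℚ :=
  fun lam mu => (schurPoly (rowVec lam)).coeff (Finsupp.equivFunOnFinite.symm (rowVec mu))

/-- The entry of the inverse Kostka matrix at two arbitrary partitions; it is zero if they are
partitions of different numbers. -/
noncomputable def invKostka {d e : ℕ} (lam : d.Partition) (mu : e.Partition) : ℚ :=
  if h : e = d then (kostka d)⁻¹ lam (h ▸ mu) else 0

theorem sum_card_filter_le {d : ℕ} (s : Multiset ℕ) (hs : ∀ i ∈ s, i ≤ d) :
    ((Multiset.range d).map fun j => (s.filter fun i => j + 1 ≤ i).card).sum = s.sum := by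
  induction s using Multiset.induction_on with
  | empty => simp
  | cons a s ih =>
    have ha : a ≤ d := hs a (Multiset.mem_cons_self a s)
    have key : ((Multiset.range d).map fun j => if j + 1 ≤ a then 1 else 0).sum = a := by
      change ∑ j ∈ Finset.range d, (if j + 1 ≤ a then 1 else 0) = a
      rw [Finset.sum_boole]
      have : (Finset.range d).filter (fun j => j + 1 ≤ a) = Finset.range a := by
        ext j; simp only [Finset.mem_filter, Finset.mem_range]; omega
      rw [this]; simp
    rw [Multiset.sum_cons, ← ih fun i hi => hs i (Multiset.mem_cons_of_mem hi)]
    nth_rewrite 2 [← key]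
    rw [← Multiset.sum_map_add]
    congr 1
    refine Multiset.map_congr rfl fun j _ => ?_
    rw [Multiset.filter_cons, Multiset.card_add]
    split_ifs <;> simp

/-- The conjugate partition `lam'`, with parts `lam'_j = #{i | lam_i ≥ j}` for `j = 1, …, d`
(zeros dropped). -/
def conjPartition {d : ℕ} (lam : d.Partition) : d.Partition :=
  Nat.Partition.ofSums d
    ((Multiset.range d).map fun j => (lam.parts.filter fun i => j + 1 ≤ i).card)
    ((sum_card_filter_le lam.parts fun _ hi => Nat.Partition.le_of_mem_parts hi).trans
      lam.parts_sum)

/-- The partition `(a, b)` of `a + b` (zeros dropped). -/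
def twoPart (a b : ℕ) : (a + b).Partition :=
  Nat.Partition.ofSums (a + b) {a, b} (by simp)

/-- The set `C(u, v; σ₁, σ₂)` of partitions `(lam_1, lam_2)`, with `lam_1 ≥ lam_2 ≥ 0`, that satisfy
`lam_1 + lam_2 = u_1 + u_2 + v_1 + v_2 - 2` and `lam_2 ≥ u_{σ₁(2)} + v_{σ₂(2)}`. The indices `1, 2`
are the elements `0, 1` of `Fin 2`; the ranges only bound the entries. -/
def setC (u v : Fin 2 → ℕ) (σ₁ σ₂ : Equiv.Perm (Fin 2)) : Finset (ℕ × ℕ) :=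
  (Finset.range (u 0 + u 1 + v 0 + v 1) ×ˢ Finset.range (u 0 + u 1 + v 0 + v 1)).filter fun p =>
    p.2 ≤ p.1 ∧ p.1 + p.2 + 2 = u 0 + u 1 + v 0 + v 1 ∧ u (σ₁ 1) + v (σ₂ 1) ≤ p.2

open MvPolynomial

/-! ### Exponent vectors of partitions -/

/-! The entry $K^{-1}_{\xi\lambda}$ is the coefficient of $s_\lambda$ in $m_\xi$, hence that of
$x^{\lambda+\delta}$ in $a_\delta m_\xi$ (`inv_kostka`). Expanding $a_\delta$ over permutations
gives signed counts of the exponent vectors $\lambda+\delta-\sigma\delta$ whose nonzero entries form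
$\xi$.

Recording a multiset of parts as a monomial in `X 1`, `X 2` turns this count into a coefficient of
the Jacobi–Trudi-type determinant `shiftMatrix` (`alternantCoeff_eq_coeff_det`); parts above 2 never
occur in $\xi$, so the other variables may be set to 0. For $\lambda=(a,b)'$ the determinant is
`schurTwo a b`, the two-variable Schur polynomial in terms of $e_1,e_2$
(`det_shiftMatrix_twoColumn`).

Summing over $\eta\cup\zeta=\xi$ is taking a coefficient of a product (`coeff_mul_toFinsupp_parts`).
The theorem thus becomes the Clebsch–Gordan rule for two variables, with its truncation written as a
signed sum over $\mathfrak S_2\times\mathfrak S_2$ (`schurTwo_mul_schurTwo`). -/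

theorem List.getD_filter_ne_zero (L : List ℕ) (hL : L.Pairwise (· ≥ ·)) (i : ℕ) :
    (L.filter (· ≠ 0)).getD i 0 = L.getD i 0 := by
  induction L generalizing i with
  | nil => simp
  | cons a L ih =>
    rw [List.pairwise_cons] at hL
    by_cases ha : a = 0
    · have hz : ∀ x ∈ a :: L, x = 0 := by
        intro x hx
        rcases List.mem_cons.1 hx with rfl | hx
        · exact ha
        · have := hL.1 x hx
          omega
      have h1 : (a :: L).filter (· ≠ 0) = [] := by
        rw [List.filter_eq_nil_iff]
        intro x hx
        simp [hz x hx]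
      rw [h1, List.getD_nil]
      rcases lt_or_ge i (a :: L).length with hi | hi
      · rw [List.getD_eq_getElem _ _ hi]
        exact (hz _ (List.getElem_mem hi)).symm
      · rw [List.getD_eq_default _ _ hi]
    · rw [List.filter_cons_of_pos (by simpa using ha)]
      cases i with
      | zero => simp
      | succ i => simpa using ih hL.2 i

theorem Multiset.sort_ge_coe_of_pairwise (L : List ℕ) (hL : L.Pairwise (· ≥ ·)) :
    (L : Multiset ℕ).sort (· ≥ ·) = L :=
  List.Perm.eq_of_pairwise' (Multiset.pairwise_sort _ _) hL
    (Multiset.coe_eq_coe.1 (Multiset.sort_eq _ _))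

/-- Zeros of a decreasing list form its tail, so the default value 0 of `getD` restores those that
`ofSums` drops. -/
theorem rowVec_ofSums_of_antitone {d : ℕ} (f : ℕ → ℕ) (hf : Antitone f)
    (h : ((Multiset.range d).map f).sum = d) (i : Fin d) :
    rowVec (Nat.Partition.ofSums d ((Multiset.range d).map f) h) i = f i := by
  have hs : ((List.range d).map f).Pairwise (· ≥ ·) := by
    rw [List.pairwise_map]
    exact (List.pairwise_lt_range (n := d)).imp fun hab => hf hab.le
  have h1 : (Multiset.range d).map f = (((List.range d).map f : List ℕ) : Multiset ℕ) := rfl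
  have h2 : (Nat.Partition.ofSums d ((Multiset.range d).map f) h).parts =
      ((((List.range d).map f).filter (· ≠ 0) : List ℕ) : Multiset ℕ) := by
    simp [Nat.Partition.ofSums, h1]
  rw [rowVec, h2, Multiset.sort_ge_coe_of_pairwise _ (hs.filter _),
    List.getD_filter_ne_zero _ hs]
  simp

theorem rowVec_antitone {d : ℕ} (P : d.Partition) : Antitone (rowVec P) := by
  intro i j hij
  have hs : (P.parts.sort (· ≥ ·)).Pairwise (· ≥ ·) := Multiset.pairwise_sort _ _
  unfold rowVec
  rcases lt_or_ge (j : ℕ) (P.parts.sort (· ≥ ·)).length with hj | hj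
  · have hi : (i : ℕ) < (P.parts.sort (· ≥ ·)).length := lt_of_le_of_lt hij hj
    rw [List.getD_eq_getElem _ _ hj, List.getD_eq_getElem _ _ hi]
    rcases eq_or_lt_of_le hij with rfl | hlt
    · exact le_rfl
    · exact List.pairwise_iff_getElem.1 hs _ _ hi hj hlt
  · rw [List.getD_eq_default _ _ hj]
    exact Nat.zero_le _

/-- The multiset of the nonzero entries of an exponent vector. -/
def nonzeroEntries {n : ℕ} (β : Fin n → ℕ) : Multiset ℕ :=
  (Finset.univ.val.map β).filter (· ≠ 0)

theorem nonzeroEntries_comp_perm {n : ℕ} (β : Fin n → ℕ) (τ : Equiv.Perm (Fin n)) :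
    nonzeroEntries (β ∘ τ) = nonzeroEntries β := by
  unfold nonzeroEntries
  rw [← Multiset.map_map, Multiset.map_univ_val_equiv]

theorem sum_nonzeroEntries {n : ℕ} (β : Fin n → ℕ) : (nonzeroEntries β).sum = ∑ i, β i := by
  unfold nonzeroEntries
  have h := Multiset.filter_add_not (· ≠ 0) (Finset.univ.val.map β)
  have h0 : ((Finset.univ.val.map β).filter fun x => ¬ x ≠ 0).sum = 0 :=
    Multiset.sum_eq_zero fun x hx => by simpa using (Multiset.mem_filter.1 hx).2
  have := congrArg Multiset.sum h
  rw [Multiset.sum_add, h0, add_zero] at this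
  exact this

theorem Nat.Partition.card_parts_le {d : ℕ} (P : d.Partition) : P.parts.card ≤ d := by
  have h : P.parts.card • 1 ≤ P.parts.sum :=
    Multiset.card_nsmul_le_sum fun x hx => P.parts_pos hx
  simpa [P.parts_sum] using h

theorem List.filter_ofFn_getD (L : List ℕ) (hL : ∀ x ∈ L, x ≠ 0) (n : ℕ) (hn : L.length ≤ n) :
    (List.ofFn fun i : Fin n => L.getD i 0).filter (· ≠ 0) = L := by
  induction L generalizing n with
  | nil => simp
  | cons a L ih =>
    cases n with
    | zero => simp at hn
    | succ n =>
      rw [List.ofFn_succ]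
      have ha : a ≠ 0 := hL a (by simp)
      have := ih (fun x hx => hL x (by simp [hx])) n (by simpa using hn)
      rw [List.filter_cons_of_pos (by simpa using ha)]
      simpa using this

theorem nonzeroEntries_rowVec {d : ℕ} (P : d.Partition) : nonzeroEntries (rowVec P) = P.parts := by
  have h := List.filter_ofFn_getD (P.parts.sort (· ≥ ·))
    (fun x hx => (P.parts_pos (by simpa using hx)).ne') d (by simpa using P.card_parts_le)
  have h1 : (Finset.univ.val.map (rowVec P) : Multiset ℕ) = (List.ofFn (rowVec P) : List ℕ) := by
    simp [Fin.univ_val_map]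
  rw [nonzeroEntries, h1, Multiset.filter_coe]
  change ((List.filter _ (List.ofFn fun i : Fin d => (P.parts.sort (· ≥ ·)).getD i 0) :
    List ℕ) : Multiset ℕ) = _
  rw [h, Multiset.sort_eq]

theorem rowVec_injective {d : ℕ} : Function.Injective (rowVec (d := d)) := fun P Q h =>
  Nat.Partition.ext (by rw [← nonzeroEntries_rowVec, h, nonzeroEntries_rowVec])

theorem sum_rowVec {d : ℕ} (P : d.Partition) : ∑ i, rowVec P i = d := by
  rw [← sum_nonzeroEntries, nonzeroEntries_rowVec, P.parts_sum]

theorem exists_rowVec_eq {d : ℕ} (f : Fin d → ℕ) (hf : Antitone f) (hd : ∑ i, f i = d) :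
    ∃ P : d.Partition, rowVec P = f := by
  set g : ℕ → ℕ := fun j => if h : j < d then f ⟨j, h⟩ else 0 with hg
  have hg' : Antitone g := by
    intro i j hij
    simp only [hg]
    split_ifs with h1 h2
    · exact hf hij
    · omega
    · exact Nat.zero_le _
    · exact le_rfl
  have hsum : ((Multiset.range d).map g).sum = d := by
    change ∑ j ∈ Finset.range d, g j = d
    rw [Finset.sum_range]
    simpa [hg] using hd
  refine ⟨_, funext fun i => (rowVec_ofSums_of_antitone g hg' hsum i).trans ?_⟩
  simp [hg]

theorem rowVec_conjPartition {d : ℕ} (P : d.Partition) (i : Fin d) :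
    rowVec (conjPartition P) i = (P.parts.filter fun k => (i : ℕ) + 1 ≤ k).card := by
  refine rowVec_ofSums_of_antitone (fun j => (P.parts.filter fun k => j + 1 ≤ k).card) ?_ _ i
  intro j k hjk
  exact Multiset.card_le_card (Multiset.monotone_filter_right _ fun x hx => by omega)

theorem rowVec_conjPartition_twoPart (a b : ℕ) (i : Fin (a + b)) :
    rowVec (conjPartition (twoPart a b)) i =
      (if (i : ℕ) < a then 1 else 0) + (if (i : ℕ) < b then 1 else 0) := by
  rw [rowVec_conjPartition]
  have h : (twoPart a b).parts = ({a, b} : Multiset ℕ).filter (· ≠ 0) := rfl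
  rw [h, Multiset.filter_filter]
  have h2 : (fun k => (i : ℕ) + 1 ≤ k ∧ k ≠ 0) = fun k => (i : ℕ) < k := by
    ext k; omega
  simp only [h2, Multiset.insert_eq_cons, Multiset.filter_cons, Multiset.filter_singleton]
  split_ifs <;> simp
/-! ### Chebyshev polynomials and determinants -/

/-- The Chebyshev-type polynomial `U_d`, the complete homogeneous polynomial of degree `d` in two
indeterminates, as a polynomial in their elementary symmetric polynomials `X 1` and `X 2`. -/
noncomputable def chebyshevTwo : ℕ → MvPolynomial ℕ ℚ
  | 0 => 1
  | 1 => X 1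
  | d + 2 => X 1 * chebyshevTwo (d + 1) - X 2 * chebyshevTwo d

/-- The generators `1, X 1, X 2`, extended by zero. -/
noncomputable def truncVar : ℕ → MvPolynomial ℕ ℚ
  | 0 => 1
  | 1 => X 1
  | 2 => X 2
  | _ + 3 => 0

/-- The matrix with entries `truncVar (f i - i + j)`, with zeros at the negative indices. -/
noncomputable def shiftMatrix (n : ℕ) (f : ℕ → ℕ) :
    Matrix (Fin n) (Fin n) (MvPolynomial ℕ ℚ) :=
  Matrix.of fun i j => if (i : ℕ) ≤ f i + j then truncVar (f i + j - i) else 0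

theorem det_shiftMatrix_zero (n : ℕ) : (shiftMatrix n fun _ => 0).det = 1 := by
  rw [Matrix.det_of_isUpperTriangular]
  · simp [shiftMatrix, truncVar]
  · intro i j hij
    have : ¬ i ≤ j := not_le.2 hij
    simp [shiftMatrix, this]

/-- Entries depend on the indices only through $j-i$, so deleting the first row and column only
shifts `f`. -/
theorem submatrix_shiftMatrix (n : ℕ) (f : ℕ → ℕ) :
    (shiftMatrix (n + 1) f).submatrix Fin.succ Fin.succ = shiftMatrix n fun i => f (i + 1) := by
  ext1 i j
  simp only [shiftMatrix, Matrix.submatrix_apply, Matrix.of_apply, Fin.val_succ]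
  have : f (i + 1) + (j + 1) - (i + 1) = f (i + 1) + j - i := by omega
  rw [this]
  exact if_congr (by omega) rfl rfl

/-- The top row is $(X_2,0,0,\ldots)$, since `truncVar` vanishes from 3 on. -/
theorem det_shiftMatrix_of_two (n : ℕ) (f : ℕ → ℕ) (hf : f 0 = 2) :
    (shiftMatrix (n + 1) f).det = X 2 * (shiftMatrix n fun i => f (i + 1)).det := by
  rw [Matrix.det_succ_row_zero, Finset.sum_eq_single 0]
  · rw [← submatrix_shiftMatrix]
    have : Fin.succAbove (0 : Fin (n + 1)) = Fin.succ := by ext; simp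
    simp [shiftMatrix, hf, truncVar, this]
  · intro j _ hj
    obtain ⟨k, rfl⟩ := Fin.exists_succ_eq.2 hj
    have : 2 + ((k : ℕ) + 1) = k + 3 := by omega
    simp [shiftMatrix, hf, this, truncVar]
  · simp

theorem det_shiftMatrix_of_one_zero (n : ℕ) (f : ℕ → ℕ) (h0 : f 0 = 1) (h1 : ∀ i, f (i + 1) = 0) :
    (shiftMatrix (n + 1) f).det = X 1 := by
  rw [Matrix.det_succ_column_zero, Finset.sum_eq_single 0]
  · have : Fin.succAbove (0 : Fin (n + 1)) = Fin.succ := by ext; simp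
    rw [this, submatrix_shiftMatrix]
    simp only [h1, det_shiftMatrix_zero]
    simp [shiftMatrix, h0, truncVar]
  · intro j _ hj
    obtain ⟨k, rfl⟩ := Fin.exists_succ_eq.2 hj
    simp [shiftMatrix, h1]
  · simp

/-- The top row is $(X_1,X_2,0,\ldots)$. In the minor belonging to $X_2$ the first column is
$(1,0,\ldots)$, because `f ≤ 1` puts zeros in column 0 from row 2 on. This matches the recurrence of
`chebyshevTwo`. -/
theorem det_shiftMatrix_of_one_one (n : ℕ) (f : ℕ → ℕ) (h0 : f 0 = 1) (h1 : f 1 = 1)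
    (h2 : ∀ i, f i ≤ 1) :
    (shiftMatrix (n + 2) f).det = X 1 * (shiftMatrix (n + 1) fun i => f (i + 1)).det -
      X 2 * (shiftMatrix n fun i => f (i + 2)).det := by
  have e0 : Fin.succAbove (0 : Fin (n + 2)) = Fin.succ := by ext; simp
  have e0' : Fin.succAbove (0 : Fin (n + 1)) = Fin.succ := by ext; simp
  rw [Matrix.det_succ_row_zero, Fin.sum_univ_succ, Fin.sum_univ_succ, Finset.sum_eq_zero, add_zero]
  · rw [e0, submatrix_shiftMatrix, sub_eq_add_neg]
    have key : ((shiftMatrix (n + 2) f).submatrix Fin.succ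
        (Fin.succ (0 : Fin (n + 1))).succAbove).det = (shiftMatrix n fun i => f (i + 2)).det := by
      rw [Matrix.det_succ_column_zero, Finset.sum_eq_single 0]
      · have h : ((shiftMatrix (n + 2) f).submatrix Fin.succ
            (Fin.succ (0 : Fin (n + 1))).succAbove).submatrix (Fin.succAbove 0) Fin.succ =
            ((shiftMatrix (n + 2) f).submatrix Fin.succ Fin.succ).submatrix Fin.succ Fin.succ := by
          rw [e0']
          ext1 i j
          simp
        rw [h, submatrix_shiftMatrix, submatrix_shiftMatrix]
        simp [shiftMatrix, h1, truncVar]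
      · intro j _ hj
        obtain ⟨k, rfl⟩ := Fin.exists_succ_eq.2 hj
        have := h2 (k + 1 + 1)
        have h3 : ¬ ((k : ℕ) + 1 + 1 ≤ f (k + 1 + 1)) := by omega
        simp [shiftMatrix, h3]
      · simp
    rw [key]
    simp [shiftMatrix, h0, truncVar]
  · intro k _
    have : 1 + ((k : ℕ) + 1 + 1) = k + 3 := by omega
    simp [shiftMatrix, h0, this, truncVar]

theorem det_shiftMatrix_eq_chebyshevTwo (d n : ℕ) (hn : d ≤ n) :
    (shiftMatrix n fun i => if i < d then 1 else 0).det = chebyshevTwo d := by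
  induction d using Nat.twoStepInduction generalizing n with
  | zero => simpa [chebyshevTwo] using det_shiftMatrix_zero n
  | one =>
    obtain ⟨n, rfl⟩ := Nat.exists_eq_add_of_le' hn
    exact det_shiftMatrix_of_one_zero n _ (by simp) (by simp)
  | more d ih1 ih2 =>
    obtain ⟨n, rfl⟩ := Nat.exists_eq_add_of_le' hn
    rw [← add_assoc, det_shiftMatrix_of_one_one _ _ (by simp) (by simp)
      (fun i => by split_ifs <;> simp), chebyshevTwo, ← ih1 (n + d) (by omega),
      ← ih2 (n + d + 1) (by omega)]
    simp

theorem det_shiftMatrix_twoColumn (b d n : ℕ) (hn : b + d ≤ n) :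
    (shiftMatrix n fun i => (if i < b + d then 1 else 0) + (if i < b then 1 else 0)).det =
      X 2 ^ b * chebyshevTwo d := by
  induction b generalizing n with
  | zero => simpa using det_shiftMatrix_eq_chebyshevTwo d n (by omega)
  | succ b ih =>
    obtain ⟨n, rfl⟩ : ∃ k, n = k + 1 := ⟨n - 1, by omega⟩
    have h : ∀ i, i + 1 < b + 1 + d ↔ i < b + d := fun i => by omega
    rw [det_shiftMatrix_of_two _ _ (by simp), pow_succ', mul_assoc, ← ih n (by omega)]
    simp [h]

/-- With `X i` of weight `i`, coefficients at partitions of the wrong size vanish, in agreement with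
the convention in `invKostka`. -/
theorem isWeightedHomogeneous_chebyshevTwo (d : ℕ) :
    IsWeightedHomogeneous (id : ℕ → ℕ) (chebyshevTwo d) d := by
  induction d using Nat.twoStepInduction with
  | zero => exact isWeightedHomogeneous_one ℚ _
  | one => exact isWeightedHomogeneous_X ℚ (id : ℕ → ℕ) 1
  | more d ih1 ih2 =>
    have h1 := (isWeightedHomogeneous_X ℚ (id : ℕ → ℕ) 1).mul ih2
    have h2 := (isWeightedHomogeneous_X ℚ (id : ℕ → ℕ) 2).mul ih1
    have e1 : id 1 + (d + 1) = d + 2 := by simp; omega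
    have e2 : id 2 + d = d + 2 := by simp; omega
    rw [e1] at h1
    rw [e2] at h2
    rw [chebyshevTwo]
    exact (weightedHomogeneousSubmodule ℚ (id : ℕ → ℕ) (d + 2)).sub_mem h1 h2

/-- For fixed `n`, all three terms satisfy the same three-term recurrence in `m`, so the cases `m =
0, 1` suffice. -/
theorem chebyshevTwo_mul_succ (m n : ℕ) :
    chebyshevTwo (m + 1) * chebyshevTwo (n + 1) =
      chebyshevTwo (m + n + 2) + X 2 * (chebyshevTwo m * chebyshevTwo n) := by
  induction m using Nat.twoStepInduction with
  | zero => simp [chebyshevTwo]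
  | one =>
    have : 1 + n + 2 = n + 1 + 2 := by omega
    rw [this]
    simp only [chebyshevTwo]
    ring
  | more m ih1 ih2 =>
    have e1 : m + 2 + n + 2 = m + n + 2 + 2 := by omega
    have e2 : m + 1 + n + 2 = m + n + 2 + 1 := by omega
    rw [e2] at ih2
    rw [e1]
    have r1 : chebyshevTwo (m + 2 + 1) =
      X 1 * chebyshevTwo (m + 1 + 1) - X 2 * chebyshevTwo (m + 1) := rfl
    have r2 : chebyshevTwo (m + 2) = X 1 * chebyshevTwo (m + 1) - X 2 * chebyshevTwo m := rfl
    have r3 : chebyshevTwo (m + n + 2 + 2) =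
      X 1 * chebyshevTwo (m + n + 2 + 1) - X 2 * chebyshevTwo (m + n + 2) := rfl
    linear_combination chebyshevTwo (n + 1) * r1 - r3 - X 2 * chebyshevTwo n * r2 + X 1 * ih2 -
      X 2 * ih1

/-- Clebsch–Gordan: each use of `chebyshevTwo_mul_succ` splits off the top term and lowers both
indices, until the smaller one is 0. -/
theorem chebyshevTwo_mul (m n : ℕ) (hmn : m ≤ n) :
    chebyshevTwo m * chebyshevTwo n =
      ∑ j ∈ Finset.range (m + 1), X 2 ^ j * chebyshevTwo (m + n - 2 * j) := by
  induction m generalizing n with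
  | zero => simp [chebyshevTwo]
  | succ m ih =>
    obtain ⟨n, rfl⟩ : ∃ k, n = k + 1 := ⟨n - 1, by omega⟩
    rw [chebyshevTwo_mul_succ, ih n (by omega), Finset.sum_range_succ' _ (m + 1), Finset.mul_sum,
      add_comm]
    congr 1
    · refine Finset.sum_congr rfl fun j _ => ?_
      rw [pow_succ', mul_assoc]
      congr 3
      omega
    · simp only [pow_zero, one_mul]
      congr 1
      omega

/-- The Schur polynomial of `(a, b)` in two indeterminates with elementary symmetric polynomials
`X 1` and `X 2`. -/
noncomputable def schurTwo (a b : ℕ) : MvPolynomial ℕ ℚ := X 2 ^ b * chebyshevTwo (a - b)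

theorem isWeightedHomogeneous_schurTwo {a b : ℕ} (hab : b ≤ a) :
    IsWeightedHomogeneous (id : ℕ → ℕ) (schurTwo a b) (a + b) := by
  have h := ((isWeightedHomogeneous_X ℚ (id : ℕ → ℕ) 2).pow b).mul
    (isWeightedHomogeneous_chebyshevTwo (a - b))
  have e : b • id 2 + (a - b) = a + b := by simp; omega
  rw [e] at h
  exact h

/-! ### The Clebsch–Gordan rule as a signed sum over pairs of permutations -/

theorem sum_setC {M : Type*} [AddCommMonoid M] (u v : Fin 2 → ℕ)
    (σ₁ σ₂ : Equiv.Perm (Fin 2)) (T : ℕ) (hT : T + 2 = u 0 + u 1 + v 0 + v 1) (F : ℕ × ℕ → M) :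
    ∑ p ∈ setC u v σ₁ σ₂, F p =
      ∑ k ∈ Finset.Ico (u (σ₁ 1) + v (σ₂ 1)) (T / 2 + 1), F (T - k, k) := by
  refine Finset.sum_bij' (fun p _ => p.2) (fun k _ => (T - k, k)) ?_ ?_ ?_ ?_ ?_
  · intro p hp
    simp only [setC, Finset.mem_filter, Finset.mem_product, Finset.mem_range] at hp
    simp only [Finset.mem_Ico]
    omega
  · intro k hk
    simp only [Finset.mem_Ico] at hk
    simp only [setC, Finset.mem_filter, Finset.mem_product, Finset.mem_range]
    omega
  · intro p hp
    simp only [setC, Finset.mem_filter, Finset.mem_product, Finset.mem_range] at hp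
    ext <;> simp; omega
  · intro k hk
    rfl
  · intro p hp
    simp only [setC, Finset.mem_filter, Finset.mem_product, Finset.mem_range] at hp
    congr 1
    ext <;> simp; omega

theorem schurTwo_mul_schurTwo (u v : Fin 2 → ℕ) (hu : u 1 < u 0) (hv : v 1 < v 0) :
    schurTwo (u 0 - 1) (u 1) * schurTwo (v 0 - 1) (v 1) =
      ∑ σ₁ : Equiv.Perm (Fin 2), ∑ σ₂ : Equiv.Perm (Fin 2),
        MvPolynomial.C (((Equiv.Perm.sign σ₁ : ℤ) : ℚ) * ((Equiv.Perm.sign σ₂ : ℤ) : ℚ)) *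
          ∑ p ∈ setC u v σ₁ σ₂, schurTwo p.1 p.2 := by
  obtain ⟨T, hT⟩ : ∃ T, T + 2 = u 0 + u 1 + v 0 + v 1 := ⟨u 0 + u 1 + v 0 + v 1 - 2, by omega⟩
  simp only [sum_setC u v _ _ T hT]
  have huniv : (Finset.univ : Finset (Equiv.Perm (Fin 2))) = {1, Equiv.swap 0 1} := by decide
  have hne : (1 : Equiv.Perm (Fin 2)) ≠ Equiv.swap 0 1 := by decide
  rw [huniv]
  simp only [Finset.sum_pair hne, Equiv.Perm.sign_one, Equiv.Perm.one_apply,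
    Equiv.swap_apply_right, Equiv.Perm.sign_swap (zero_ne_one : (0 : Fin 2) ≠ 1)]
  obtain ⟨m, hm⟩ : ∃ m, u 0 = u 1 + m + 1 := ⟨u 0 - u 1 - 1, by omega⟩
  obtain ⟨n, hn⟩ : ∃ n, v 0 = v 1 + n + 1 := ⟨v 0 - v 1 - 1, by omega⟩
  generalize u 0 = u0 at *
  generalize u 1 = a at *
  generalize v 0 = v0 at *
  generalize v 1 = b at *
  subst hm hn
  have hLHS : schurTwo (a + m + 1 - 1) a * schurTwo (b + n + 1 - 1) b =
      X 2 ^ (a + b) * (chebyshevTwo m * chebyshevTwo n) := by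
    simp only [schurTwo, Nat.add_sub_cancel, Nat.add_sub_cancel_left, pow_add]
    ring
  -- Clebsch–Gordan fills the interval from $a+b$ to $a+b+p$, with $p$ the smaller index; the rest,
  -- up to $T/2$, is what a single transposition subtracts.
  have key : ∀ p q : ℕ, p ≤ q → p + q = m + n →
      X 2 ^ (a + b) * (chebyshevTwo p * chebyshevTwo q) +
        ∑ k ∈ Finset.Ico (a + b + p + 1) (T / 2 + 1), schurTwo (T - k) k =
      ∑ k ∈ Finset.Ico (a + b) (T / 2 + 1), schurTwo (T - k) k := by
    intro p q hpq hs
    have h1 : ∑ k ∈ Finset.Ico (a + b) (a + b + p + 1), schurTwo (T - k) k =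
        X 2 ^ (a + b) * (chebyshevTwo p * chebyshevTwo q) := by
      rw [chebyshevTwo_mul p q hpq, Finset.mul_sum, Finset.sum_Ico_eq_sum_range]
      refine Finset.sum_congr (by congr 1; omega) fun j _ => ?_
      rw [schurTwo, ← mul_assoc, ← pow_add]
      congr 2
      omega
    rw [← h1]
    rcases le_or_gt (a + b + p + 1) (T / 2 + 1) with h | h
    · exact Finset.sum_Ico_consecutive _ (by omega) h
    · omega
  rw [hLHS]
  -- As $T=2(a+b)+m+n$, the term with two transpositions is empty, and so is the single
  -- transposition on the side of the larger of $m,n$.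
  rw [Finset.Ico_eq_empty_of_le (show T / 2 + 1 ≤ a + m + 1 + (b + n + 1) by omega)]
  rcases le_total m n with h | h
  · rw [Finset.Ico_eq_empty_of_le (show T / 2 + 1 ≤ a + (b + n + 1) by omega), ← key m n h rfl,
      show a + m + 1 + b = a + b + m + 1 by omega]
    simp
  · rw [Finset.Ico_eq_empty_of_le (show T / 2 + 1 ≤ a + m + 1 + b by omega),
      ← key n m h (add_comm _ _), show a + (b + n + 1) = a + b + n + 1 by omega]
    simp [mul_comm]

/-! ### Antisymmetric polynomials -/

theorem rename_perm_prod_X_pow {n : ℕ} (σ : Equiv.Perm (Fin n)) (α : Fin n → ℕ) :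
    rename σ (∏ i, (X i : MvPolynomial (Fin n) ℚ) ^ α i) =
      monomial (Finsupp.equivFunOnFinite.symm (α ∘ σ.symm)) 1 := by
  rw [monomial_eq, map_prod, C_1, one_mul, Finsupp.prod_fintype _ _ (fun i => pow_zero _),
    ← Equiv.prod_comp σ (fun i => X i ^ _)]
  simp

theorem alternant_eq_sum_monomial {n : ℕ} (α : Fin n → ℕ) :
    alternant α = ∑ σ : Equiv.Perm (Fin n),
      monomial (Finsupp.equivFunOnFinite.symm (α ∘ σ.symm)) ((Equiv.Perm.sign σ : ℤ) : ℚ) := by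
  refine Finset.sum_congr rfl fun σ _ => ?_
  rw [rename_perm_prod_X_pow]
  have h : (((Equiv.Perm.sign σ : ℤ) : MvPolynomial (Fin n) ℚ)) =
    C (((Equiv.Perm.sign σ : ℤ) : ℚ)) := by simp
  rw [h, C_mul_monomial, mul_one]

theorem coeff_alternant_of_strictAnti {n : ℕ} {α β : Fin n → ℕ} (hα : StrictAnti α)
    (hβ : StrictAnti β) :
    (alternant α).coeff (Finsupp.equivFunOnFinite.symm β) = if α = β then 1 else 0 := by
  rw [alternant_eq_sum_monomial, coeff_sum, Finset.sum_eq_single 1]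
  · have h1 : α ∘ (1 : Equiv.Perm (Fin n)).symm = α := rfl
    simp [coeff_monomial, h1]
  · intro σ _ hσ
    rw [coeff_monomial, if_neg]
    intro h
    have h' : α ∘ σ.symm = β := Finsupp.equivFunOnFinite.symm.injective h
    apply hσ
    -- A permutation carrying one strictly decreasing vector to another preserves order, and `Fin n`
    -- has no nontrivial order automorphism.
    have hmono : StrictMono σ.symm := by
      intro i j hij
      have := hβ hij
      rw [← h'] at this
      exact hα.lt_iff_gt.1 this
    have h1 : ∀ i, σ.symm i = i := fun i => by
      have := (Subsingleton.elim (hmono.orderIsoOfSurjective _ σ.symm.surjective)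
        (OrderIso.refl (Fin n)))
      exact congrArg (fun e : Fin n ≃o Fin n => e i) this
    ext i
    have := h1 (σ i)
    simp only [Equiv.symm_apply_apply] at this
    simp [← this]
  · simp

theorem rename_alternant {n : ℕ} (τ : Equiv.Perm (Fin n)) (α : Fin n → ℕ) :
    rename τ (alternant α) = C ((Equiv.Perm.sign τ : ℤ) : ℚ) * alternant α := by
  simp only [alternant]
  rw [map_sum, Finset.mul_sum]
  refine Fintype.sum_equiv (Equiv.mulLeft τ) _ _ fun σ => ?_
  have hs : ((Equiv.Perm.sign τ : ℤ) : MvPolynomial (Fin n) ℚ) *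
      ((Equiv.Perm.sign τ : ℤ) : MvPolynomial (Fin n) ℚ) = 1 := by
    rcases Int.units_eq_one_or (Equiv.Perm.sign τ) with h | h <;> simp [h]
  rw [map_mul, rename_rename]
  simp only [Equiv.coe_mulLeft, map_intCast, Equiv.Perm.sign_mul, Units.val_mul, Int.cast_mul,
    Equiv.Perm.coe_mul]
  rw [← mul_assoc, ← mul_assoc, hs, one_mul]

theorem exists_perm_strictAnti {n : ℕ} (β : Fin n → ℕ) (hβ : Function.Injective β) :
    ∃ τ : Equiv.Perm (Fin n), StrictAnti (β ∘ τ) := by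
  refine ⟨Fin.revPerm.trans (Tuple.sort β), ?_⟩
  have h : StrictMono (β ∘ Tuple.sort β) :=
    (Tuple.monotone_sort β).strictMono_of_injective (hβ.comp (Tuple.sort β).injective)
  intro i j hij
  exact h (Fin.rev_lt_rev.2 hij)

/-- An antisymmetric polynomial is determined by its coefficients at the strictly decreasing
exponent vectors. -/
theorem eq_zero_of_antisymmetric {n : ℕ} (f : MvPolynomial (Fin n) ℚ)
    (hf : ∀ τ : Equiv.Perm (Fin n), rename τ f = C ((Equiv.Perm.sign τ : ℤ) : ℚ) * f)
    (h : ∀ α : Fin n → ℕ, StrictAnti α → f.coeff (Finsupp.equivFunOnFinite.symm α) = 0) :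
    f = 0 := by
  have key : ∀ (τ : Equiv.Perm (Fin n)) (β : Fin n → ℕ),
      f.coeff (Finsupp.equivFunOnFinite.symm (β ∘ τ)) =
        ((Equiv.Perm.sign τ : ℤ) : ℚ) * f.coeff (Finsupp.equivFunOnFinite.symm β) := by
    intro τ β
    have h1 := coeff_rename_mapDomain τ τ.injective f (Finsupp.equivFunOnFinite.symm (β ∘ τ))
    rw [hf, coeff_C_mul] at h1
    rw [← h1]
    congr 2
    ext i
    rw [← Finsupp.equivMapDomain_eq_mapDomain]
    simp
  ext d
  obtain ⟨β, rfl⟩ := Finsupp.equivFunOnFinite.symm.surjective d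
  rw [coeff_zero]
  by_cases hβ : Function.Injective β
  · obtain ⟨τ, hτ⟩ := exists_perm_strictAnti β hβ
    have h1 := key τ β
    rw [h _ hτ] at h1
    rcases Int.units_eq_one_or (Equiv.Perm.sign τ) with hs | hs <;> rw [hs] at h1 <;> simpa using h1.symm
  · obtain ⟨i, j, hij, hne⟩ := Function.not_injective_iff.1 hβ
    have h1 := key (Equiv.swap i j) β
    have h2 : β ∘ Equiv.swap i j = β := by
      ext k
      by_cases hk : k = i
      · simp [hk, hij]
      · by_cases hk' : k = j
        · simp [hk', hij]
        · simp [Equiv.swap_apply_of_ne_of_ne hk hk']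
    -- Swapping equal exponents fixes the coefficient but negates it, so it is zero.
    rw [h2, Equiv.Perm.sign_swap hne] at h1
    have : (((-1 : ℤˣ) : ℤ) : ℚ) = -1 := by simp
    rw [this] at h1
    linarith

theorem staircase_strictAnti (n : ℕ) : StrictAnti (staircase n) := by
  intro i j hij
  have : (i : ℕ) < j := hij
  have := j.isLt
  simp only [staircase]
  omega

theorem alternant_staircase_ne_zero (n : ℕ) : alternant (staircase n) ≠ 0 := by
  intro h
  have := coeff_alternant_of_strictAnti (staircase_strictAnti n) (staircase_strictAnti n)
  simp [h] at this

theorem isHomogeneous_alternant {n : ℕ} (α : Fin n → ℕ) :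
    (alternant α).IsHomogeneous (∑ i, α i) := by
  rw [alternant_eq_sum_monomial]
  refine IsHomogeneous.sum _ _ _ fun σ _ => isHomogeneous_monomial _ ?_
  rw [Finsupp.degree_eq_sum]
  simpa using Equiv.sum_comp σ.symm α

/-! ### Monomial symmetric polynomials and the inverse Kostka matrix -/

/-- The monomial symmetric polynomial of a partition of `d` in `d` variables. -/
noncomputable def monomialSymm {d : ℕ} (ξ : d.Partition) : MvPolynomial (Fin d) ℚ :=
  ∑ β ∈ (Fintype.piFinset fun _ : Fin d => Finset.range (d + 1)).filter
    (fun β => nonzeroEntries β = ξ.parts), monomial (Finsupp.equivFunOnFinite.symm β) 1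

theorem coeff_monomialSymm {d : ℕ} (ξ : d.Partition) (β : Fin d → ℕ) :
    (monomialSymm ξ).coeff (Finsupp.equivFunOnFinite.symm β) =
      if nonzeroEntries β = ξ.parts then 1 else 0 := by
  simp only [monomialSymm, coeff_sum, coeff_monomial, EmbeddingLike.apply_eq_iff_eq]
  rw [Finset.sum_ite_eq']
  refine if_congr ?_ rfl rfl
  simp only [Finset.mem_filter, Fintype.mem_piFinset, Finset.mem_range, and_iff_right_iff_imp]
  intro h i
  have h1 := sum_nonzeroEntries β
  rw [h, ξ.parts_sum] at h1
  have := Finset.single_le_sum (f := β) (fun _ _ => Nat.zero_le _) (Finset.mem_univ i)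
  omega

theorem rename_monomialSymm {d : ℕ} (ξ : d.Partition) (τ : Equiv.Perm (Fin d)) :
    rename τ (monomialSymm ξ) = monomialSymm ξ := by
  ext e
  obtain ⟨β, rfl⟩ := Finsupp.equivFunOnFinite.symm.surjective e
  have h : Finsupp.equivFunOnFinite.symm β =
      (Finsupp.equivFunOnFinite.symm (β ∘ τ)).mapDomain τ := by
    ext i
    rw [← Finsupp.equivMapDomain_eq_mapDomain]
    simp
  rw [h, coeff_rename_mapDomain τ τ.injective, ← h, coeff_monomialSymm, coeff_monomialSymm,
    nonzeroEntries_comp_perm]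

theorem isHomogeneous_monomialSymm {d : ℕ} (ξ : d.Partition) :
    (monomialSymm ξ).IsHomogeneous d := by
  refine IsHomogeneous.sum _ _ _ fun β hβ => isHomogeneous_monomial _ ?_
  rw [Finsupp.degree_eq_sum]
  have h1 := sum_nonzeroEntries β
  rw [(Finset.mem_filter.1 hβ).2, ξ.parts_sum] at h1
  simpa using h1.symm

theorem strictAnti_rowVec_add_staircase {d : ℕ} (P : d.Partition) :
    StrictAnti (rowVec P + staircase d) :=
  (rowVec_antitone P).add_strictAnti (staircase_strictAnti d)

theorem exists_rowVec_add_staircase_eq {d : ℕ} (α : Fin d → ℕ) (hα : StrictAnti α)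
    (hd : ∑ i, α i = ∑ i, staircase d i + d) :
    ∃ P : d.Partition, rowVec P + staircase d = α := by
  have hle : ∀ i, staircase d i ≤ α i := by
    have : ∀ k : ℕ, ∀ i : Fin d, d - 1 - i = k → k ≤ α i := by
      intro k
      induction k with
      | zero => exact fun i _ => Nat.zero_le _
      | succ k ih =>
        intro i hi
        have h1 : (i : ℕ) + 1 < d := by omega
        have h2 := ih ⟨i + 1, h1⟩ (by simp; omega)
        have h3 : α ⟨i + 1, h1⟩ < α i := hα (Fin.mk_lt_mk.2 (Nat.lt_succ_self _) : i < ⟨i + 1, h1⟩)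
        omega
    exact fun i => this _ i rfl
  have hanti : Antitone fun i => α i - staircase d i := by
    have : ∀ k : ℕ, ∀ i j : Fin d, (i : ℕ) + k = j → α j + k ≤ α i := by
      intro k
      induction k with
      | zero =>
        intro i j h
        have : i = j := Fin.ext h
        simp [this]
      | succ k ih =>
        intro i j h
        have h1 : (i : ℕ) + 1 < d := by omega
        have h2 := ih ⟨i + 1, h1⟩ j (by simp; omega)
        have h3 : α ⟨i + 1, h1⟩ < α i := hα (Fin.mk_lt_mk.2 (Nat.lt_succ_self _) : i < ⟨i + 1, h1⟩)
        omega
    intro i j hij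
    have h1 := this (j - i) i j (by have : (i : ℕ) ≤ j := hij; omega)
    have h2 := hle j
    have h3 := hle i
    have h4 : (i : ℕ) ≤ j := hij
    have := j.isLt
    simp only [staircase] at *
    omega
  obtain ⟨P, hP⟩ := exists_rowVec_eq _ hanti (by
    have := Finset.sum_add_distrib (s := Finset.univ) (f := fun i => α i - staircase d i)
      (g := staircase d)
    simp only [Nat.sub_add_cancel (hle _)] at this
    omega)
  refine ⟨P, funext fun i => ?_⟩
  rw [hP]
  exact Nat.sub_add_cancel (hle i)

/-- The entry of the inverse Kostka matrix as a coefficient of `a_δ m_ξ`. -/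
noncomputable def alternantCoeff (d : ℕ) : Matrix d.Partition d.Partition ℚ := fun ξ lam =>
  (alternant (staircase d) * monomialSymm ξ).coeff
    (Finsupp.equivFunOnFinite.symm (rowVec lam + staircase d))

/-- Both sides are antisymmetric, so strictly decreasing exponents suffice; those of the right total
degree are exactly the $\lambda+\delta$. -/
theorem sum_alternantCoeff_smul_alternant {d : ℕ} (ξ : d.Partition) :
    ∑ lam, C (alternantCoeff d ξ lam) * alternant (rowVec lam + staircase d) =
      alternant (staircase d) * monomialSymm ξ := by
  rw [← sub_eq_zero]
  apply eq_zero_of_antisymmetric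
  · intro τ
    simp only [map_sub, map_sum, map_mul, rename_C, rename_alternant, rename_monomialSymm]
    rw [mul_sub, Finset.mul_sum, mul_assoc]
    congr 1
    exact Finset.sum_congr rfl fun _ _ => mul_left_comm _ _ _
  · intro α hα
    rw [coeff_sub, coeff_sum, sub_eq_zero]
    simp only [coeff_C_mul, coeff_alternant_of_strictAnti (strictAnti_rowVec_add_staircase _) hα]
    by_cases hd : ∑ i, α i = ∑ i, staircase d i + d
    · obtain ⟨P, rfl⟩ := exists_rowVec_add_staircase_eq α hα hd
      simp only [add_left_inj, rowVec_injective.eq_iff]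
      simp [alternantCoeff]
    · have h := (isHomogeneous_alternant (staircase d)).mul (isHomogeneous_monomialSymm ξ)
      rw [h.coeff_eq_zero (by rw [Finsupp.degree_eq_sum]; simpa using hd)]
      refine Finset.sum_eq_zero fun P _ => ?_
      rw [if_neg, mul_zero]
      rintro rfl
      apply hd
      simp [Finset.sum_add_distrib, sum_rowVec, add_comm]

theorem sum_alternantCoeff_smul_schurPoly {d : ℕ} (ξ : d.Partition) :
    ∑ lam, C (alternantCoeff d ξ lam) * schurPoly (rowVec lam) = monomialSymm ξ := by
  apply mul_left_cancel₀ (alternant_staircase_ne_zero d)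
  rw [← sum_alternantCoeff_smul_alternant, Finset.mul_sum]
  exact Finset.sum_congr rfl fun lam _ => by rw [mul_left_comm, schurPoly_spec]

/-- Comparing coefficients of $x^\mu$ in the Schur expansion of $m_\xi$ exhibits a left inverse. -/
theorem inv_kostka (d : ℕ) : (kostka d)⁻¹ = alternantCoeff d := by
  apply Matrix.inv_eq_left_inv
  ext ξ μ
  have h := congrArg (coeff (Finsupp.equivFunOnFinite.symm (rowVec μ)))
    (sum_alternantCoeff_smul_schurPoly ξ)
  rw [coeff_sum, coeff_monomialSymm, nonzeroEntries_rowVec] at h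
  simp only [coeff_C_mul] at h
  rw [Matrix.mul_apply, Matrix.one_apply]
  refine h.trans (if_congr ?_ rfl rfl)
  rw [Nat.Partition.ext_iff, eq_comm]

/-! ### The entries at two-column shapes -/

theorem truncVar_eq_monomial {k : ℕ} (hk : k ≤ 2) :
    truncVar k = monomial (Multiset.toFinsupp (({k} : Multiset ℕ).filter (· ≠ 0))) 1 := by
  have h : ∀ j : ℕ, X (j + 1) =
      monomial (Multiset.toFinsupp (({j + 1} : Multiset ℕ).filter (· ≠ 0))) (1 : ℚ) := fun j => by
    rw [Multiset.filter_singleton, if_pos (Nat.succ_ne_zero j), Multiset.toFinsupp_singleton, X]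
  interval_cases k
  · rw [Multiset.filter_singleton, if_neg (by simp)]
    simp [truncVar]
  · exact h 0
  · exact h 1

/-- Zero entries contribute the factor 1 and entries 1, 2 a variable each; an entry above 2 kills
the product and cannot occur in `s`. -/
theorem coeff_prod_truncVar {n : ℕ} (s : Multiset ℕ) (hs : ∀ i ∈ s, i ≤ 2) (β : Fin n → ℕ) :
    (∏ i, truncVar (β i)).coeff (Multiset.toFinsupp s) =
      if nonzeroEntries β = s then 1 else 0 := by
  by_cases hβ : ∀ i, β i ≤ 2
  · have h1 : ∏ i, truncVar (β i) = monomial (Multiset.toFinsupp (nonzeroEntries β)) 1 := by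
      have h2 : nonzeroEntries β = ∑ i, ({β i} : Multiset ℕ).filter (· ≠ 0) := by
        have : (Finset.univ.val.map β) = ∑ i, ({β i} : Multiset ℕ) := by
          rw [Finset.sum, ← Multiset.sum_map_singleton (Finset.univ.val.map β), Multiset.map_map]
          rfl
        rw [nonzeroEntries, this]
        exact map_sum (⟨⟨Multiset.filter (· ≠ 0), rfl⟩, fun a b => Multiset.filter_add _ a b⟩ :
          Multiset ℕ →+ Multiset ℕ) _ _
      rw [h2, map_sum, monomial_sum_one]
      exact Finset.prod_congr rfl fun i _ => truncVar_eq_monomial (hβ i)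
    rw [h1, coeff_monomial]
    exact if_congr (EmbeddingLike.apply_eq_iff_eq _) rfl rfl
  · push Not at hβ
    obtain ⟨i, hi⟩ := hβ
    obtain ⟨k, hk⟩ := Nat.exists_eq_add_of_le' (show 3 ≤ β i from hi)
    rw [Finset.prod_eq_zero (Finset.mem_univ i) (by rw [hk]; rfl), coeff_zero, if_neg]
    rintro rfl
    have := hs (β i) (by
      refine Multiset.mem_filter.2 ⟨Multiset.mem_map_of_mem _ (Finset.mem_univ i), ?_⟩
      omega)
    omega

/-- The two permutation expansions agree term by term: $\lambda+\delta-\sigma\delta$ has $i$-th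
entry $f(i)+\sigma^{-1}(i)-i$, the index of `truncVar` in the matrix. -/
theorem alternantCoeff_eq_coeff_det {d : ℕ} (ξ lam : d.Partition) (hξ : ∀ i ∈ ξ.parts, i ≤ 2)
    (f : ℕ → ℕ) (hf : ∀ i, rowVec lam i = f i) :
    alternantCoeff d ξ lam = (shiftMatrix d f).det.coeff (Multiset.toFinsupp ξ.parts) := by
  rw [alternantCoeff, alternant_eq_sum_monomial, Finset.sum_mul, coeff_sum, Matrix.det_apply',
    coeff_sum]
  refine Finset.sum_congr rfl fun σ _ => ?_
  have hC : (((Equiv.Perm.sign σ : ℤ) : MvPolynomial ℕ ℚ)) =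
    C (((Equiv.Perm.sign σ : ℤ) : ℚ)) := by simp
  rw [coeff_monomial_mul', hC, coeff_C_mul, ← Equiv.prod_comp σ.symm]
  simp only [Equiv.apply_symm_apply]
  have hiff : ∀ i j : Fin d, staircase d j ≤ (rowVec lam + staircase d) i ↔
      (i : ℕ) ≤ f i + j := by
    intro i j
    have := i.isLt
    have := j.isLt
    simp only [Pi.add_apply, hf, staircase]
    omega
  split_ifs with h
  · have h' : ∀ i, staircase d (σ.symm i) ≤ (rowVec lam + staircase d) i := fun i => h i
    have hsub : Finsupp.equivFunOnFinite.symm (rowVec lam + staircase d) -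
        Finsupp.equivFunOnFinite.symm (staircase d ∘ σ.symm) =
        Finsupp.equivFunOnFinite.symm fun i : Fin d => f i + σ.symm i - i := by
      ext i
      have := h' i
      have := i.isLt
      have := (σ.symm i).isLt
      simp only [Pi.add_apply, hf, staircase, Finsupp.coe_tsub, Pi.sub_apply,
        Finsupp.equivFunOnFinite_symm_apply_apply, Function.comp_apply] at *
      omega
    rw [hsub, coeff_monomialSymm, ← coeff_prod_truncVar ξ.parts hξ]
    congr 2
    refine Finset.prod_congr rfl fun i _ => ?_
    rw [shiftMatrix, Matrix.of_apply, if_pos ((hiff _ _).1 (h' i))]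
  -- A negative exponent corresponds to a matrix entry that is zero by definition.
  · have h' : ∃ i, ¬ staircase d (σ.symm i) ≤ (rowVec lam + staircase d) i := by
      by_contra! hc
      exact h fun i => hc i
    obtain ⟨i, hi⟩ := h'
    rw [Finset.prod_eq_zero (Finset.mem_univ i), coeff_zero, mul_zero]
    rw [shiftMatrix, Matrix.of_apply, if_neg (fun hc => hi ((hiff _ _).2 hc))]

theorem weight_toFinsupp (s : Multiset ℕ) :
    Finsupp.weight (id : ℕ → ℕ) (Multiset.toFinsupp s) = s.sum := by
  induction s using Multiset.induction_on with
  | empty => simp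
  | cons a s ih =>
    rw [← Multiset.singleton_add, map_add, map_add, ih, Multiset.sum_add]
    simp [Finsupp.weight_single]

theorem invKostka_conjPartition_twoPart {N : ℕ} (ξ : N.Partition) (hξ : ∀ i ∈ ξ.parts, i ≤ 2)
    {a b : ℕ} (hab : b ≤ a) :
    invKostka ξ (conjPartition (twoPart a b)) =
      (schurTwo a b).coeff (Multiset.toFinsupp ξ.parts) := by
  by_cases h : a + b = N
  · subst h
    rw [invKostka, dif_pos rfl, inv_kostka]
    change alternantCoeff _ ξ (conjPartition (twoPart a b)) = _
    rw [alternantCoeff_eq_coeff_det ξ _ hξ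
      (fun i => (if i < a then 1 else 0) + (if i < b then 1 else 0)) (rowVec_conjPartition_twoPart a b), schurTwo,
      ← det_shiftMatrix_twoColumn b (a - b) (a + b) (by omega), Nat.add_sub_cancel' hab]
  · rw [invKostka, dif_neg h, (isWeightedHomogeneous_schurTwo hab).coeff_eq_zero]
    rw [weight_toFinsupp, ξ.parts_sum]
    exact Ne.symm h

/-- Splittings of the exponent of $X^\xi$ are splittings of the multiset of parts; both pieces have
positive parts, and their sums determine the pair `d`. -/
theorem coeff_mul_toFinsupp_parts {N : ℕ} (ξ : N.Partition) (p q : MvPolynomial ℕ ℚ) :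
    (p * q).coeff (Multiset.toFinsupp ξ.parts) =
      ∑ d ∈ Finset.HasAntidiagonal.antidiagonal N, ∑ η : d.1.Partition, ∑ ζ : d.2.Partition,
        if η.parts + ζ.parts = ξ.parts then
          p.coeff (Multiset.toFinsupp η.parts) * q.coeff (Multiset.toFinsupp ζ.parts)
        else 0 := by
  classical
  simp only [← Fintype.sum_prod_type']
  rw [Finset.sum_sigma' (Finset.HasAntidiagonal.antidiagonal N)
    (fun d => (Finset.univ : Finset (d.1.Partition × d.2.Partition))), ← Finset.sum_filter,
    coeff_mul]
  symm
  refine Finset.sum_bij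
    (fun x _ => (Multiset.toFinsupp x.2.1.parts, Multiset.toFinsupp x.2.2.parts)) ?_ ?_ ?_ ?_
  · rintro ⟨⟨a, b⟩, η, ζ⟩ hx
    have := (Finset.mem_filter.1 hx).2
    rw [Finset.HasAntidiagonal.mem_antidiagonal, ← map_add, this]
  · rintro ⟨⟨a, b⟩, η, ζ⟩ _ ⟨⟨a', b'⟩, η', ζ'⟩ _ h
    simp only [Prod.mk.injEq, EmbeddingLike.apply_eq_iff_eq] at h
    obtain rfl : a = a' := η.parts_sum.symm.trans ((congrArg _ h.1).trans η'.parts_sum)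
    obtain rfl : b = b' := ζ.parts_sum.symm.trans ((congrArg _ h.2).trans ζ'.parts_sum)
    obtain rfl := Nat.Partition.ext h.1
    obtain rfl := Nat.Partition.ext h.2
    rfl
  · rintro ⟨x, y⟩ hxy
    obtain ⟨s, rfl⟩ := Multiset.toFinsupp.surjective x
    obtain ⟨t, rfl⟩ := Multiset.toFinsupp.surjective y
    rw [Finset.HasAntidiagonal.mem_antidiagonal, ← map_add, EmbeddingLike.apply_eq_iff_eq] at hxy
    have hsum : s.sum + t.sum = N := by rw [← Multiset.sum_add, hxy, ξ.parts_sum]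
    refine ⟨⟨(s.sum, t.sum), ⟨s, fun {i} hi => ξ.parts_pos ?_, rfl⟩,
      ⟨t, fun {i} hi => ξ.parts_pos ?_, rfl⟩⟩, ?_, rfl⟩
    · rw [← hxy]
      exact Multiset.mem_add.2 (Or.inl hi)
    · rw [← hxy]
      exact Multiset.mem_add.2 (Or.inr hi)
    · simp [hsum, hxy]
  · intro x _
    rfl

theorem mainTheorem4 (N : ℕ) (ξ : N.Partition) (hξ : ∀ i ∈ ξ.parts, i ≤ 2)
    (u v : Fin 2 → ℕ) (hu : u 1 < u 0) (hv : v 1 < v 0) :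
    (∑ d ∈ Finset.HasAntidiagonal.antidiagonal N, ∑ η : d.1.Partition, ∑ ζ : d.2.Partition,
        if (∀ i ∈ η.parts, i ≤ 2) ∧ (∀ i ∈ ζ.parts, i ≤ 2) ∧ η.parts + ζ.parts = ξ.parts then
          invKostka η (conjPartition (twoPart (u 0 - 1) (u 1))) *
            invKostka ζ (conjPartition (twoPart (v 0 - 1) (v 1)))
        else 0) =
      ∑ σ₁ : Equiv.Perm (Fin 2), ∑ σ₂ : Equiv.Perm (Fin 2),
        ((Equiv.Perm.sign σ₁ : ℤ) : ℚ) * ((Equiv.Perm.sign σ₂ : ℤ) : ℚ) *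
          ∑ p ∈ setC u v σ₁ σ₂, invKostka ξ (conjPartition (twoPart p.1 p.2)) := by
  have h := congrArg (coeff (Multiset.toFinsupp ξ.parts)) (schurTwo_mul_schurTwo u v hu hv)
  rw [coeff_mul_toFinsupp_parts] at h
  simp only [coeff_sum, coeff_C_mul] at h
  convert h using 1
  · refine Finset.sum_congr rfl fun d _ => Finset.sum_congr rfl fun η _ =>
      Finset.sum_congr rfl fun ζ _ => ?_
    by_cases hηζ : η.parts + ζ.parts = ξ.parts
    · have hη : ∀ i ∈ η.parts, i ≤ 2 := fun i hi =>
        hξ i (hηζ ▸ Multiset.mem_add.2 (Or.inl hi))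
      have hζ : ∀ i ∈ ζ.parts, i ≤ 2 := fun i hi =>
        hξ i (hηζ ▸ Multiset.mem_add.2 (Or.inr hi))
      rw [if_pos ⟨hη, hζ, hηζ⟩, if_pos hηζ, invKostka_conjPartition_twoPart η hη (by omega),
        invKostka_conjPartition_twoPart ζ hζ (by omega)]
    · rw [if_neg hηζ, if_neg fun hc => hηζ hc.2.2]
  · refine Finset.sum_congr rfl fun σ₁ _ => Finset.sum_congr rfl fun σ₂ _ => ?_
    congr 1
    refine Finset.sum_congr rfl fun p hp => invKostka_conjPartition_twoPart ξ hξ ?_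
    exact (Finset.mem_filter.1 hp).2.1
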